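/- For every Polish group $G$ (a topological group whose topology is separable and completely metrizable) there exist a separable real Banach space $E$ and a nonzero vector $e \in E$ such that $G$ is isomorphic, as a topological group (that is, via a group isomorphism which is also a homeomorphism), to the group of all surjective linear isometries $T\colon E \to E$ with $T(e) = e$, endowed with the topology of pointwise convergence (the coarsest topology making $T \mapsto T(x)$ norm-continuous for every $x \in E$). -/

import Mathlib

/-- The topology of pointwise convergence on the group `E ≃ₗᵢ[ℝ] E` of all (surjective) linear
isometries of a real normed space `E`: the coarsest topology making every evaluation
`T ↦ T x` continuous, where `E` carries its norm topology. -/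
instance LinearIsometryEquiv.pointwiseTopology (E : Type*) [NormedAddCommGroup E]
    [NormedSpace ℝ E] : TopologicalSpace (E ≃ₗᵢ[ℝ] E) :=
  TopologicalSpace.induced (fun (T : E ≃ₗᵢ[ℝ] E) (x : E) => T x) Pi.topologicalSpace

/-- The group of all (surjective) linear isometries of `E` which leave the point `e` fixed.
As a subgroup of `E ≃ₗᵢ[ℝ] E` it carries the pointwise convergence topology. -/
def linearIsometriesFixing (E : Type*) [NormedAddCommGroup E] [NormedSpace ℝ E] (e : E) :
    Subgroup (E ≃ₗᵢ[ℝ] E) where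
  carrier := {T | T e = e}
  one_mem' := rfl
  mul_mem' := by
    intro S T hS hT
    change S (T e) = e
    rw [show T e = e from hT]
    exact hS
  inv_mem' := by
    intro T hT
    change T.symm e = e
    rw [LinearIsometryEquiv.symm_apply_eq]
    exact (show T e = e from hT).symm

/-! Countably many copies of `G` and a base point form a pseudometric space `Colored ρ h` on which
`G` acts by left translations. Its Dirac measures span a dense subspace of the Banach space
`LipFree`, and `e` is the Dirac measure at the base point.

Dirac measures are strongly exposed (`norm_sub_δ_le`) and the atomic elements norm the dual
(`apply_le_of_forall_isAtomic`), so a linear isometry `T` sends each Dirac measure into the closure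
of the atomic elements. If `T` fixes `e`, distances to `e`, which lie strictly between 1 and 2 for
the other Dirac measures, rule out every atom that is not a Dirac measure (`exists_norm_δ_sub_lt`).
These distances also label the copies, so `T` preserves the closure of each copy.

That closure may exceed the copy, as a Polish group need not have a complete left-invariant metric;
but the copy is a dense Gδ in it, so by Baire `T` sends some point `a` of copy 1 to a point `b` of
copy 1. After a left translation `T` fixes `a`. Distances between copies encode right translations
by a dense sequence `h`, which spreads this fixed point to all copies (`eq_one_of_apply_δ_pt_eq`).
Hence `T` is a left translation. -/

open Filter Topology Set

/-! ### Left-invariant pseudometrics -/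

/-- A left-invariant pseudometric, bounded by `1` and inducing the topology of `G`. -/
structure LeftInvariantDist (G : Type*) [Group G] [TopologicalSpace G] where
  d : G → G → ℝ
  self : ∀ x, d x x = 0
  symm : ∀ x y, d x y = d y x
  triangle : ∀ x y z, d x z ≤ d x y + d y z
  le_one : ∀ x y, d x y ≤ 1
  left_inv : ∀ g x y, d (g * x) (g * y) = d x y
  tendsto : ∀ x, Tendsto (d x) (𝓝 x) (𝓝 0)
  mem_nhds : ∀ x, ∀ U ∈ 𝓝 x, ∃ ε > 0, ∀ y, d x y < ε → y ∈ U

theorem LeftInvariantDist.nonneg {G : Type*} [Group G] [TopologicalSpace G]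
    (ρ : LeftInvariantDist G) (x y : G) : 0 ≤ ρ.d x y := by
  have h1 := ρ.triangle x y x
  have h2 := ρ.symm x y
  have h3 := ρ.self x
  linarith

/-- Birkhoff–Kakutani: take a pseudometric for the left uniformity, truncate it at 1, and take the
supremum over left translates. The topology survives because the entourages `x⁻¹ * y ∈ V` are
left-invariant. -/
theorem exists_leftInvariantDist (G : Type*) [Group G] [TopologicalSpace G] [IsTopologicalGroup G]
    [FirstCountableTopology G] : Nonempty (LeftInvariantDist G) := by
  let : UniformSpace G := IsTopologicalGroup.leftUniformSpace G
  have : (uniformity G).IsCountablyGenerated :=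
    inferInstanceAs (comap (fun p : G × G => p.1⁻¹ * p.2) (𝓝 1)).IsCountablyGenerated
  let : PseudoMetricSpace G := UniformSpace.pseudoMetricSpace G
  have bdd : ∀ x y : G, BddAbove (range fun g : G => min (dist (g * x) (g * y)) 1) := fun x y =>
    ⟨1, by rintro _ ⟨g, rfl⟩; exact min_le_right _ _⟩
  have hsmall : ∀ ε > 0, ∃ V ∈ 𝓝 (1 : G), ∀ x y : G, x⁻¹ * y ∈ V → dist x y < ε := by
    intro ε hε
    have h : {p : G × G | dist p.1 p.2 < ε} ∈ uniformity G := Metric.dist_mem_uniformity hε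
    obtain ⟨V, hV, hVs⟩ := mem_comap.1
      (show _ ∈ comap (fun p : G × G => p.1⁻¹ * p.2) (𝓝 1) from h)
    exact ⟨V, hV, fun x y hxy => hVs (show (x, y) ∈ _ from hxy)⟩
  have hge : ∀ x y : G, min (dist x y) 1 ≤ ⨆ g : G, min (dist (g * x) (g * y)) 1 := fun x y => by
    simpa using le_ciSup (bdd x y) 1
  refine ⟨⟨fun x y => ⨆ g : G, min (dist (g * x) (g * y)) 1, ?_, ?_, ?_, ?_, ?_, ?_, ?_⟩⟩
  · intro x; simp
  · intro x y; simp [dist_comm]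
  · intro x y z
    refine ciSup_le fun g => ?_
    have h1 := le_ciSup (bdd x y) g
    have h2 := le_ciSup (bdd y z) g
    have h3 := dist_triangle (g * x) (g * y) (g * z)
    have h4 := @dist_nonneg _ _ (g * x) (g * y)
    have h5 := @dist_nonneg _ _ (g * y) (g * z)
    refine le_trans ?_ (add_le_add h1 h2)
    simp only [min_def]
    split_ifs <;> linarith
  · exact fun x y => ciSup_le fun g => min_le_right _ _
  · intro g x y
    simp only [← mul_assoc]
    exact (Equiv.mulRight g).iSup_comp (g := fun k : G => min (dist (k * x) (k * y)) 1)
  · intro x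
    rw [Metric.tendsto_nhds]
    intro ε hε
    obtain ⟨V, hV, h⟩ := hsmall (ε / 2) (by positivity)
    have : Tendsto (fun y => x⁻¹ * y) (𝓝 x) (𝓝 1) := by
      simpa using (continuous_const_mul x⁻¹).tendsto x
    filter_upwards [this hV] with y hy
    have h0 : 0 ≤ ⨆ g : G, min (dist (g * x) (g * y)) 1 :=
      (le_min dist_nonneg zero_le_one).trans (hge x y)
    rw [Real.dist_eq, sub_zero, abs_of_nonneg h0]
    refine (ciSup_le fun g => (min_le_left _ _).trans (h _ _ ?_).le).trans_lt (half_lt_self hε)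
    simpa [mul_assoc] using hy
  · intro x U hU
    obtain ⟨ε, hε, h⟩ := Metric.mem_nhds_iff.1 hU
    refine ⟨min ε 1, by positivity, fun y hy => h ?_⟩
    have h1 := (hge x y).trans_lt hy
    rw [Metric.mem_ball, dist_comm]
    by_contra! hcon
    exact absurd h1 (not_lt.2 (min_le_min_right _ hcon))

/-! ### Baire category -/

/-- A dense completely metrizable subspace of a Hausdorff space is a `Gδ` set. -/
theorem Topology.IsInducing.isGδ_range_of_dense {X Y : Type*} [TopologicalSpace X]
    [TopologicalSpace Y] [T2Space Y] [TopologicalSpace.IsCompletelyMetrizableSpace X] {j : X → Y}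
    (hj : IsInducing j) (hd : DenseRange j) : IsGδ (range j) := by
  let := TopologicalSpace.upgradeIsCompletelyMetrizable X
  let V : ℕ → Set Y := fun n =>
    ⋃₀ {V | IsOpen V ∧ ∀ a b, j a ∈ V → j b ∈ V → dist a b < 1 / ((n : ℝ) + 1)}
  have hV : ∀ n, IsOpen (V n) := fun n => isOpen_sUnion fun _ h => h.1
  suffices h : range j = ⋂ n, V n by
    rw [h]; exact IsGδ.iInter_of_isOpen hV
  refine Subset.antisymm ?_ ?_
  · rintro _ ⟨x, rfl⟩
    refine mem_iInter.2 fun n => ?_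
    have hpos : (0 : ℝ) < 1 / ((n : ℝ) + 1) / 2 := by positivity
    obtain ⟨W, hW, hWb⟩ := hj.isOpen_iff.1 (Metric.isOpen_ball (x := x)
      (ε := 1 / ((n : ℝ) + 1) / 2))
    have hmem : ∀ a, j a ∈ W → dist a x < 1 / ((n : ℝ) + 1) / 2 := fun a ha => by
      have : a ∈ j ⁻¹' W := ha
      rwa [hWb] at this
    refine ⟨W, ⟨hW, fun a b ha hb => ?_⟩, ?_⟩
    · have := dist_triangle_right a b x
      linarith [hmem a ha, hmem b hb]
    · have : x ∈ j ⁻¹' W := by rw [hWb]; exact Metric.mem_ball_self hpos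
      exact this
  -- A point in every `V n` has neighbourhoods with arbitrarily small traces on `X`, so the trace
  -- filter is Cauchy; the image of its limit is `y`.
  · intro y hy
    have : (comap j (𝓝 y)).NeBot :=
      comap_neBot fun t ht => by
        obtain ⟨_, h1, x, rfl⟩ := mem_closure_iff_nhds.1 (hd y) t ht
        exact ⟨x, h1⟩
    have hc : Cauchy (comap j (𝓝 y)) := by
      refine Metric.cauchy_iff.2 ⟨inferInstance, fun ε hε => ?_⟩
      obtain ⟨n, hn⟩ := exists_nat_one_div_lt hε
      obtain ⟨W, ⟨hWo, hW⟩, hyW⟩ := mem_iInter.1 hy n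
      exact ⟨j ⁻¹' W, preimage_mem_comap (hWo.mem_nhds hyW),
        fun a ha b hb => (hW a b ha hb).trans hn⟩
    obtain ⟨x, hx⟩ := CompleteSpace.complete hc
    have h1 : Tendsto j (comap j (𝓝 y)) (𝓝 (j x)) := (hj.continuous.tendsto x).mono_left hx
    exact ⟨x, tendsto_nhds_unique h1 tendsto_comap⟩

/-- A self-homeomorphism of a Baire space maps some point of a dense completely metrizable
subspace to a point of the same subspace. -/
theorem Homeomorph.exists_apply_eq_of_denseRange {X Y : Type*} [TopologicalSpace X]
    [TopologicalSpace Y] [T2Space Y] [BaireSpace Y] [Nonempty Y] [TopologicalSpace.IsCompletelyMetrizableSpace X]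
    {j : X → Y} (hj : IsInducing j) (hd : DenseRange j) (T : Y ≃ₜ Y) :
    ∃ a b, T (j a) = j b := by
  have h1 := hj.isGδ_range_of_dense hd
  have h2 : IsGδ (T ⁻¹' range j) := h1.preimage T.continuous
  have h3 : Dense (T ⁻¹' range j) := hd.preimage T.isOpenMap
  obtain ⟨_, ⟨a, rfl⟩, b, hb⟩ := (Dense.inter_of_Gδ h1 h2 hd h3).nonempty
  exact ⟨a, b, hb.symm⟩

/-! ### The Banach space generated by Dirac measures -/

/-- The functions on `Y` which are bounded by `1` and `1`-Lipschitz. -/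
structure LipBall (Y : Type*) [PseudoMetricSpace Y] where
  toFun : Y → ℝ
  abs_le : ∀ y, |toFun y| ≤ 1
  sub_le : ∀ y z, toFun y - toFun z ≤ dist y z

namespace LipBall

variable {Y : Type*} [PseudoMetricSpace Y]

/-- With the discrete topology, `BoundedContinuousFunction` on the ball means all bounded functions.
-/
instance : TopologicalSpace (LipBall Y) := ⊥
instance : DiscreteTopology (LipBall Y) := ⟨rfl⟩

/-- Precomposition with an isometry. -/
def comp (f : LipBall Y) (σ : Y ≃ᵢ Y) : LipBall Y :=
  ⟨fun y => f.1 (σ y), fun _ => f.abs_le _, fun y z => (f.sub_le _ _).trans (σ.isometry.dist_eq y z).le⟩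

/-- A multiple of a function lying in the ball. -/
noncomputable def ofScaled (f : Y → ℝ) (c : ℝ) (hc : 0 < c) (h1 : ∀ y, |f y| ≤ c)
    (h2 : ∀ y z, f y - f z ≤ c * dist y z) : LipBall Y :=
  ⟨fun y => c⁻¹ * f y, fun y => by
    rw [abs_mul, abs_of_pos (inv_pos.2 hc), inv_mul_le_iff₀ hc]; simpa using h1 y, fun y z => by
    rw [← mul_sub, inv_mul_le_iff₀ hc]; exact h2 y z⟩

theorem ofScaled_val {f : Y → ℝ} {c : ℝ} (hc : 0 < c) (h1 : ∀ y, |f y| ≤ c)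
    (h2 : ∀ y z, f y - f z ≤ c * dist y z) (y : Y) : f y = c * (ofScaled f c hc h1 h2).1 y := by
  simp only [ofScaled]
  rw [mul_inv_cancel_left₀ hc.ne']

/-- The evaluation at a point, as a function on the ball. -/
noncomputable def dirac (y : Y) : BoundedContinuousFunction (LipBall Y) ℝ :=
  BoundedContinuousFunction.ofNormedAddCommGroupDiscrete (fun f => f.1 y) 1 fun f => f.abs_le y

end LipBall

/-- The completion of the space of finitely supported measures on `Y` with respect to the norm
dual to the bounded Lipschitz norm. -/
noncomputable def lipFreeSubmodule (Y : Type*) [PseudoMetricSpace Y] :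
    Submodule ℝ (BoundedContinuousFunction (LipBall Y) ℝ) :=
  (Submodule.span ℝ (range LipBall.dirac)).topologicalClosure

/-- The Banach space whose underlying set is `lipFreeSubmodule Y`. -/
def LipFree (Y : Type*) [PseudoMetricSpace Y] : Type _ := lipFreeSubmodule Y

namespace LipFree

open LipBall

variable {Y : Type*} [PseudoMetricSpace Y]

noncomputable instance : NormedAddCommGroup (LipFree Y) :=
  inferInstanceAs (NormedAddCommGroup (lipFreeSubmodule Y))

noncomputable instance : NormedSpace ℝ (LipFree Y) :=
  inferInstanceAs (NormedSpace ℝ (lipFreeSubmodule Y))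

instance : CompleteSpace (LipFree Y) :=
  inferInstanceAs (CompleteSpace (Submodule.span ℝ (range LipBall.dirac)).topologicalClosure)

/-- The inclusion into the space of bounded functions on the ball. -/
noncomputable def incl : LipFree Y →ₗᵢ[ℝ] BoundedContinuousFunction (LipBall Y) ℝ :=
  { toFun := fun v => v.1
    map_add' := fun _ _ => rfl
    map_smul' := fun _ _ => rfl
    norm_map' := fun _ => rfl }

/-- The Dirac measure at `y`. -/
noncomputable def δ (y : Y) : LipFree Y :=
  ⟨dirac y, Submodule.le_topologicalClosure _ (Submodule.subset_span ⟨y, rfl⟩)⟩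

/-- Evaluation at `f`, i.e. integration of `f`. -/
noncomputable def eval (f : LipBall Y) : LipFree Y →L[ℝ] ℝ :=
  (BoundedContinuousFunction.evalCLM ℝ f).comp incl.toContinuousLinearMap

@[simp] theorem eval_δ (f : LipBall Y) (y : Y) : eval f (δ y) = f.1 y := rfl

theorem dense_span_range_δ :
    Dense (Submodule.span ℝ (range (δ : Y → LipFree Y)) : Set (LipFree Y)) := by
  intro v
  have hv : incl v ∈ closure (Submodule.span ℝ (range (dirac : Y → _)) : Set _) := v.2
  have hr : range (dirac : Y → _) = (incl (Y := Y)).toLinearMap '' range δ := by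
    rw [← range_comp]; rfl
  rw [incl.isometry.isEmbedding.isInducing.closure_eq_preimage_closure_image]
  rw [hr, Submodule.span_image] at hv
  exact hv

theorem ext_δ {F : Type*} [NormedAddCommGroup F] [NormedSpace ℝ F] {A B : LipFree Y →L[ℝ] F}
    (h : ∀ y, A (δ y) = B (δ y)) : A = B :=
  ContinuousLinearMap.ext_on dense_span_range_δ (by rintro _ ⟨y, rfl⟩; exact h y)

theorem eval_le_norm (f : LipBall Y) (v : LipFree Y) : |eval f v| ≤ ‖v‖ :=
  BoundedContinuousFunction.norm_coe_le_norm v.1 f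

/-- One-sided bounds suffice because the ball is stable under negation. -/
theorem norm_le {v : LipFree Y} {C : ℝ} (hC : 0 ≤ C) (h : ∀ f, eval f v ≤ C) : ‖v‖ ≤ C := by
  refine (BoundedContinuousFunction.norm_le hC).2 fun f => _root_.abs_le.2 ⟨?_, h f⟩
  let g : LipBall Y := ⟨fun y => -f.1 y, fun y => by rw [abs_neg]; exact f.abs_le y, fun y z => by
    have := f.sub_le z y
    rw [dist_comm] at this
    linarith⟩
  have hg : eval g = -eval f := ext_δ fun y => by simp [g]
  have := h g
  rw [hg] at this
  change - C ≤ eval f v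
  simp at this
  linarith

theorem norm_δ_sub_le (y z : Y) : ‖δ y - δ z‖ ≤ dist y z :=
  norm_le dist_nonneg fun f => by simpa using f.sub_le y z

/-- The function `dist x · - 1`. -/
noncomputable def _root_.LipBall.distSubOne (hD : ∀ y z : Y, dist y z ≤ 2) (x : Y) : LipBall Y :=
  ⟨fun y => dist y x - 1, fun y => _root_.abs_le.2 ⟨by linarith [@dist_nonneg _ _ y x],
    by linarith [hD y x]⟩, fun y z => by linarith [dist_triangle y z x]⟩

/-- The function `1 - dist x · / 2`. -/
noncomputable def _root_.LipBall.peak (hD : ∀ y z : Y, dist y z ≤ 2) (x : Y) : LipBall Y :=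
  ⟨fun y => 1 - dist y x / 2, fun y => _root_.abs_le.2 ⟨by linarith [hD y x],
    by linarith [@dist_nonneg _ _ y x]⟩, fun y z => by
      linarith [dist_triangle z y x, dist_comm z y, @dist_nonneg _ _ y z]⟩

/-- Diameter at most 2 is what puts the norming function `dist · z - 1` in the ball. -/
theorem norm_δ_sub (hD : ∀ y z : Y, dist y z ≤ 2) (y z : Y) : ‖δ y - δ z‖ = dist y z := by
  refine le_antisymm (norm_δ_sub_le y z) ?_
  have := (le_abs_self _).trans (eval_le_norm (distSubOne hD z) (δ y - δ z))
  simpa [distSubOne] using this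

theorem norm_δ (y : Y) : ‖δ y‖ = 1 := by
  refine le_antisymm (norm_le zero_le_one fun f => (le_abs_self _).trans (f.abs_le y)) ?_
  exact (le_abs_self _).trans (eval_le_norm ⟨fun _ => 1, by simp, by simp⟩ (δ y))

/-! ### Linear isometries and Dirac measures -/

/-- Dirac measures are strongly exposed points of the unit ball. -/
theorem norm_sub_δ_le (hD : ∀ y z : Y, dist y z ≤ 2) (x : Y) {u : LipFree Y} (hu : ‖u‖ ≤ 1) :
    ‖u - δ x‖ ≤ 4 * (1 - eval (peak hD x) u) := by
  have h1 := (abs_le.1 (eval_le_norm (peak hD x) u)).2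
  refine norm_le (by linarith) fun f => ?_
  have hfx := abs_le.1 (f.abs_le x)
  have hpos : 0 < 4 + f.1 x := by linarith
  -- The weight 4 makes `f + 4 * peak` attain its sup norm `4 + f x` at `x`, and keeps its Lipschitz
  -- constant, at most 3, below `4 + f x`.
  have hb : ∀ y, |f.1 y + 4 * (peak hD x).1 y| ≤ 4 + f.1 x := fun y => by
    have hfy := abs_le.1 (f.abs_le y)
    have h2 := f.sub_le y x
    have h3 := hD y x
    have h4 := @dist_nonneg _ _ y x
    simp only [peak]
    exact _root_.abs_le.2 ⟨by linarith, by linarith⟩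
  have hl : ∀ y z, (f.1 y + 4 * (peak hD x).1 y) - (f.1 z + 4 * (peak hD x).1 z) ≤
      (4 + f.1 x) * dist y z := fun y z => by
    have h2 := f.sub_le y z
    have h3 := dist_triangle z y x
    rw [dist_comm z y] at h3
    have h4 : 3 * dist y z ≤ (4 + f.1 x) * dist y z :=
      mul_le_mul_of_nonneg_right (by linarith) dist_nonneg
    simp only [peak]
    linarith
  have hg : eval f + (4 : ℝ) • eval (peak hD x) =
      (4 + f.1 x) • eval (ofScaled _ _ hpos hb hl) :=
    ext_δ fun y => by simpa using ofScaled_val hpos hb hl y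
  have h5 := congrArg (fun A : LipFree Y →L[ℝ] ℝ => A u) hg
  simp only [add_apply, smul_apply, smul_eq_mul] at h5
  have h6 := (abs_le.1 ((eval_le_norm (ofScaled _ _ hpos hb hl) u).trans hu)).2
  have h7 := mul_le_mul_of_nonneg_left h6 hpos.le
  simp only [map_sub, eval_δ]
  linarith

/-- The molecules `(δ y - δ z) / dist y z` together with the Dirac measures and their opposites. -/
inductive IsAtomic : LipFree Y → Prop
  | pos (z : Y) : IsAtomic (δ z)
  | neg (z : Y) : IsAtomic (-δ z)
  | molecule (y z : Y) (h : 0 < dist y z) : IsAtomic ((dist y z)⁻¹ • (δ y - δ z))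

theorem IsAtomic.norm_le_one {c : LipFree Y} (hc : IsAtomic c) : ‖c‖ ≤ 1 := by
  cases hc with
  | pos z => exact (norm_δ z).le
  | neg z => rw [norm_neg]; exact (norm_δ z).le
  | molecule y z h =>
    rw [norm_smul, norm_inv, Real.norm_of_nonneg h.le, inv_mul_le_iff₀ h, mul_one]
    exact norm_δ_sub_le y z

/-- A bound by `θ` on atomic elements says exactly that `y ↦ A (δ y)` is `θ` times an element of the
ball. Dually, the unit ball is the closed convex hull of the atomic elements. -/
theorem apply_le_of_forall_isAtomic {A : LipFree Y →L[ℝ] ℝ} {θ : ℝ} (hθ : 0 < θ)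
    (h : ∀ c, IsAtomic c → A c ≤ θ) (v : LipFree Y) : A v ≤ θ * ‖v‖ := by
  have hb : ∀ y, |A (δ y)| ≤ θ := fun y => abs_le.2
    ⟨by have := h _ (.neg y); rw [map_neg] at this; linarith, h _ (.pos y)⟩
  have hl : ∀ y z, A (δ y) - A (δ z) ≤ θ * dist y z := fun y z => by
    rcases (@dist_nonneg _ _ y z).eq_or_lt with h0 | h0
    · have h1 : δ y - δ z = 0 := norm_le_zero_iff.1 ((norm_δ_sub_le y z).trans h0.symm.le)
      rw [← map_sub, h1, ← h0]; simp
    · have h1 := h _ (.molecule y z h0)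
      rw [map_smul, smul_eq_mul, inv_mul_le_iff₀ h0, map_sub] at h1
      linarith
  have hA : A = θ • eval (ofScaled _ _ hθ hb hl) :=
    ext_δ fun y => by simpa using ofScaled_val hθ hb hl y
  rw [hA]
  exact mul_le_mul_of_nonneg_left ((le_abs_self _).trans (eval_le_norm _ v)) hθ.le

/-- A linear isometry maps Dirac measures into the closure of the set of atomic elements. -/
theorem exists_isAtomic_norm_sub_le (hD : ∀ y z : Y, dist y z ≤ 2)
    (T : LipFree Y ≃ₗᵢ[ℝ] LipFree Y) (x : Y) {ε : ℝ} (hε : 0 < ε) (hε1 : ε < 1) :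
    ∃ c, IsAtomic c ∧ ‖c - T (δ x)‖ ≤ 4 * ε := by
  by_contra! hcon
  let A : LipFree Y →L[ℝ] ℝ :=
    (eval (peak hD x)).comp (T.symm.toContinuousLinearEquiv : LipFree Y →L[ℝ] LipFree Y)
  have hA : ∀ v, A v = eval (peak hD x) (T.symm v) := fun _ => rfl
  -- If all atoms were far from `T (δ x)`, strong exposure would give `A ≤ 1 - ε` on the unit ball,
  -- whereas `A (T (δ x)) = 1`.
  have h := apply_le_of_forall_isAtomic (A := A) (θ := 1 - ε) (by linarith) (fun c hc => by
    by_contra! hlt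
    have h1 := hcon c hc
    rw [hA] at hlt
    have h2 := norm_sub_δ_le hD x (u := T.symm c) (by rw [T.symm.norm_map]; exact hc.norm_le_one)
    rw [← T.norm_map, map_sub, T.apply_symm_apply] at h2
    linarith) (T (δ x))
  rw [hA, T.symm_apply_apply, T.norm_map, norm_δ] at h
  simp [peak] at h
  linarith

/-- The data of a base point which is far from all other points. -/
structure IsFarPoint (o : Y) : Prop where
  dist_le_two : ∀ y z : Y, dist y z ≤ 2
  one_lt : ∀ y, y ≠ o → 1 < dist y o
  lt_two : ∀ y, dist y o < 2
  dist_le : ∀ y z, y ≠ o → dist y z ≤ dist y o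

/-- For a molecule starting at `o`, the difference is minus a convex combination of Dirac measures.
Otherwise a test function equal to -1 at both `z` and `o`, with slope 1 from `z` to `y`, gives 2. -/
theorem IsAtomic.norm_sub_δ {o : Y} (ho : IsFarPoint o) {c : LipFree Y} (hc : IsAtomic c) :
    (∃ z, c = δ z) ∨ 2 ≤ ‖c - δ o‖ ∨ ‖c - δ o‖ ≤ 1 := by
  cases hc with
  | pos z => exact .inl ⟨z, rfl⟩
  | neg z =>
    have h := (neg_le_abs _).trans (eval_le_norm ⟨fun _ => 1, by simp, by simp⟩ (-δ z - δ o))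
    simp only [map_sub, map_neg, eval_δ] at h
    exact .inr (.inl (by linarith))
  | molecule y z h =>
    by_cases hy : y = o
    · subst hy
      right; right
      have hz : z ≠ y := by rintro rfl; simp at h
      have h1 := ho.one_lt z hz
      rw [dist_comm] at h1
      have h2 : (dist y z)⁻¹ ≤ 1 := inv_le_one_of_one_le₀ h1.le
      have h3 : (0 : ℝ) ≤ (dist y z)⁻¹ := inv_nonneg.2 h.le
      have : (dist y z)⁻¹ • (δ y - δ z) - δ y =
          -((1 - (dist y z)⁻¹) • δ y + (dist y z)⁻¹ • δ z) := by module
      rw [this, norm_neg]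
      refine (norm_add_le _ _).trans ?_
      rw [norm_smul, norm_smul, norm_δ, norm_δ, Real.norm_of_nonneg h3,
        Real.norm_of_nonneg (by linarith)]
      linarith
    · right; left
      let f : LipBall Y := ⟨fun u => min (dist u z) (dist u o) - 1, fun u => abs_le.2
        ⟨by linarith [le_min (@dist_nonneg _ _ u z) (@dist_nonneg _ _ u o)],
          by linarith [min_le_left (dist u z) (dist u o), ho.dist_le_two u z]⟩, fun u v => by
          have h1 := dist_triangle u v z
          have h2 := dist_triangle u v o
          have : min (dist u z) (dist u o) ≤ dist u v + min (dist v z) (dist v o) := by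
            rw [← min_add_add_left]; exact min_le_min h1 h2
          linarith⟩
      have h1 := (le_abs_self _).trans (eval_le_norm f ((dist y z)⁻¹ • (δ y - δ z) - δ o))
      have hfy : f.1 y = dist y z - 1 := by simp only [f]; rw [min_eq_left (ho.dist_le y z hy)]
      have hfz : f.1 z = - 1 := by simp [f]
      have hfo : f.1 o = - 1 := by simp [f]
      simp only [map_sub, map_smul, eval_δ, smul_eq_mul, hfy, hfz, hfo] at h1
      have h2 : (dist y z)⁻¹ * (dist y z - 1 - -1) = 1 := by
        rw [sub_neg_eq_add, sub_add_cancel, inv_mul_cancel₀ h.ne']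
      linarith

/-- A linear isometry fixing the Dirac measure at a far point preserves the closure of the set of
Dirac measures. -/
theorem exists_norm_δ_sub_lt {o : Y} (ho : IsFarPoint o) (T : LipFree Y ≃ₗᵢ[ℝ] LipFree Y)
    (hT : T (δ o) = δ o) (x : Y) {ε : ℝ} (hε : 0 < ε) : ∃ z, ‖δ z - T (δ x)‖ < ε := by
  by_cases hx : x = o
  · exact ⟨o, by simpa [hx, hT] using hε⟩
  have h1 := ho.one_lt x hx
  have h2 := ho.lt_two x
  -- An error below the gaps from `dist x o` to 1 and to 2 leaves only Dirac measures; `η / 4`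
  -- offsets the factor 4 in the approximation.
  obtain ⟨η, hη, hlt⟩ := exists_between
    (show 0 < min (min ε 1) (min (dist x o - 1) (2 - dist x o)) by
      refine lt_min (lt_min hε one_pos) (lt_min ?_ ?_) <;> linarith)
  simp only [lt_min_iff] at hlt
  obtain ⟨c, hc, hcn⟩ := exists_isAtomic_norm_sub_le ho.dist_le_two T x (ε := η / 4)
    (by linarith) (by linarith)
  have h3 : ‖T (δ x) - δ o‖ = dist x o := by
    rw [← norm_δ_sub ho.dist_le_two, ← T.norm_map (δ x - δ o), map_sub, hT]
  have h4 := norm_sub_le_norm_sub_add_norm_sub c (T (δ x)) (δ o)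
  have h5 := norm_sub_le_norm_sub_add_norm_sub (T (δ x)) c (δ o)
  rw [norm_sub_rev (T (δ x)) c] at h5
  rcases hc.norm_sub_δ ho with ⟨z, rfl⟩ | h6 | h6
  · exact ⟨z, by linarith⟩
  · linarith
  · linarith

/-! ### Functoriality, separability and pointwise continuity -/

/-- The linear isometry induced by a self-isometry of `Y`. -/
noncomputable def mapL (σ : Y ≃ᵢ Y) : LipFree Y →L[ℝ] LipFree Y :=
  let A : BoundedContinuousFunction (LipBall Y) ℝ →L[ℝ] BoundedContinuousFunction (LipBall Y) ℝ :=
    LinearMap.mkContinuous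
      { toFun := fun v => v.compContinuous ⟨fun f => f.comp σ, continuous_of_discreteTopology⟩
        map_add' := fun _ _ => rfl
        map_smul' := fun _ _ => rfl } 1 fun v => by
      rw [one_mul]
      exact (BoundedContinuousFunction.norm_le (norm_nonneg _)).2 fun f => v.norm_coe_le_norm _
  have hA : ∀ w ∈ lipFreeSubmodule Y, A w ∈ lipFreeSubmodule Y := fun w hw => by
    have hspan : ∀ w ∈ Submodule.span ℝ (range (dirac : Y → _)), A w ∈ lipFreeSubmodule Y := by
      intro w hw
      induction hw using Submodule.span_induction with
      | mem w hw =>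
        obtain ⟨y, rfl⟩ := hw
        exact (δ (σ y)).2
      | zero => rw [map_zero]; exact zero_mem _
      | add a b _ _ ha hb => rw [map_add]; exact add_mem ha hb
      | smul c a _ ha => rw [map_smul]; exact Submodule.smul_mem _ _ ha
    exact closure_minimal hspan
      ((Submodule.isClosed_topologicalClosure _).preimage A.continuous) hw
  LinearMap.mkContinuous
    { toFun := fun v => ⟨A v.1, hA v.1 v.2⟩
      map_add' := fun v w => Subtype.ext (A.map_add v.1 w.1)
      map_smul' := fun c v => Subtype.ext (A.map_smul c v.1) } 1 fun v => by
    rw [one_mul]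
    exact (BoundedContinuousFunction.norm_le (norm_nonneg _)).2 fun f => v.1.norm_coe_le_norm _

@[simp] theorem mapL_δ (σ : Y ≃ᵢ Y) (y : Y) : mapL σ (δ y) = δ (σ y) := rfl

theorem norm_mapL_le (σ : Y ≃ᵢ Y) (v : LipFree Y) : ‖mapL σ v‖ ≤ ‖v‖ :=
  norm_le (norm_nonneg _) fun f => (le_abs_self _).trans (eval_le_norm (f.comp σ) v)

theorem mapL_mul (σ τ : Y ≃ᵢ Y) (v : LipFree Y) : mapL (σ * τ) v = mapL σ (mapL τ v) :=
  congrArg (fun A : LipFree Y →L[ℝ] LipFree Y => A v)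
    (ext_δ (A := mapL (σ * τ)) (B := (mapL σ).comp (mapL τ)) fun y => by simp)

theorem mapL_one (v : LipFree Y) : mapL (1 : Y ≃ᵢ Y) v = v :=
  congrArg (fun A : LipFree Y →L[ℝ] LipFree Y => A v)
    (ext_δ (A := mapL 1) (B := ContinuousLinearMap.id ℝ _) fun y => by simp)

/-- The action of the isometry group of `Y` on `LipFree Y` by linear isometries. -/
noncomputable def map : (Y ≃ᵢ Y) →* (LipFree Y ≃ₗᵢ[ℝ] LipFree Y) where
  toFun σ :=
    { toFun := mapL σ
      map_add' := map_add _
      map_smul' := map_smul _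
      invFun := mapL σ⁻¹
      left_inv := fun v => by rw [← mapL_mul, inv_mul_cancel, mapL_one]
      right_inv := fun v => by rw [← mapL_mul, mul_inv_cancel, mapL_one]
      norm_map' := fun v => by
        refine le_antisymm (norm_mapL_le σ v) ?_
        have := norm_mapL_le σ⁻¹ (mapL σ v)
        rwa [← mapL_mul, inv_mul_cancel, mapL_one] at this }
  map_one' := by ext1 v; exact mapL_one v
  map_mul' σ τ := by ext1 v; exact mapL_mul σ τ v

@[simp] theorem map_δ (σ : Y ≃ᵢ Y) (y : Y) : map σ (δ y) = δ (σ y) := rfl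

theorem isometryEquiv_ext_δ {S T : LipFree Y ≃ₗᵢ[ℝ] LipFree Y} (h : ∀ y, S (δ y) = T (δ y)) :
    S = T := by
  ext1 v
  exact congrArg (fun A : LipFree Y →L[ℝ] LipFree Y => A v)
    (ext_δ (A := (S.toContinuousLinearEquiv : LipFree Y →L[ℝ] LipFree Y))
      (B := (T.toContinuousLinearEquiv : LipFree Y →L[ℝ] LipFree Y)) h)

theorem separableSpace (h : TopologicalSpace.IsSeparable (range (δ : Y → LipFree Y))) :
    TopologicalSpace.SeparableSpace (LipFree Y) := by
  have := (h.span (R := ℝ)).closure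
  rw [dense_span_range_δ.closure_eq] at this
  exact TopologicalSpace.isSeparable_univ_iff.1 this

/-- A family of linear isometries is continuous for pointwise convergence as soon as its values at
Dirac measures are. -/
theorem continuous_of_forall_δ {X : Type*} [TopologicalSpace X]
    {F : X → (LipFree Y ≃ₗᵢ[ℝ] LipFree Y)} (h : ∀ y, Continuous fun x => F x (δ y))
    (v : LipFree Y) : Continuous fun x => F x v := by
  have hspan : ∀ w ∈ Submodule.span ℝ (range (δ : Y → LipFree Y)), Continuous fun x => F x w := by
    intro w hw
    induction hw using Submodule.span_induction with
    | mem w hw => obtain ⟨y, rfl⟩ := hw; exact h y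
    | zero => simpa using continuous_const
    | add a b _ _ ha hb => simpa using! ha.add hb
    | smul c a _ ha => simpa using! ha.const_smul c
  refine continuous_iff_continuousAt.2 fun x => Metric.tendsto_nhds.2 fun ε hε => ?_
  obtain ⟨w, hw, hvw⟩ := Metric.dense_iff.1 (dense_span_range_δ (Y := Y)) v (ε / 3) (by positivity)
  filter_upwards [Metric.tendsto_nhds.1 ((hspan w hvw).tendsto x) (ε / 3) (by positivity)] with x' hx'
  have h1 : dist (F x' v) (F x' w) = dist w v := by
    rw [(F x').isometry.dist_eq, dist_comm]
  have h2 : dist (F x w) (F x v) = dist w v := (F x).isometry.dist_eq _ _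
  have h3 := dist_triangle4 (F x' v) (F x' w) (F x w) (F x v)
  rw [Metric.mem_ball] at hw
  linarith

end LipFree

/-! ### The coloured pseudometric space -/

namespace LeftInvariantDist

variable {G : Type*} [Group G] [TopologicalSpace G] (ρ : LeftInvariantDist G) (h : ℕ → G)

/-- A left-invariant pseudometric for which right translations by `h n` are Lipschitz. -/
noncomputable def fine (x y : G) : ℝ :=
  1 / 2 * ρ.d x y + ∑' n, (1 / 2 : ℝ) ^ (n + 2) * ρ.d (x * h n) (y * h n)

/-- With the weight 1/2 of `ρ.d` the total is 1, whence `fine_le_one`. -/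
theorem hasSum_weights : HasSum (fun n : ℕ => (1 / 2 : ℝ) ^ (n + 2)) (1 / 2) := by
  have := (hasSum_geometric_two).mul_left ((1 / 2 : ℝ) ^ 2)
  simp only [← pow_add, add_comm 2] at this
  norm_num at this ⊢
  exact this

theorem summable_fine (x y : G) :
    Summable fun n => (1 / 2 : ℝ) ^ (n + 2) * ρ.d (x * h n) (y * h n) :=
  hasSum_weights.summable.of_nonneg_of_le (fun n => mul_nonneg (by positivity) (ρ.nonneg _ _))
    fun n => mul_le_of_le_one_right (by positivity) (ρ.le_one _ _)

theorem fine_self (x : G) : ρ.fine h x x = 0 := by simp [fine, ρ.self]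

theorem fine_symm (x y : G) : ρ.fine h x y = ρ.fine h y x := by
  simp only [fine, ρ.symm x y, ρ.symm (x * _) (y * _)]

theorem fine_triangle (x y z : G) : ρ.fine h x z ≤ ρ.fine h x y + ρ.fine h y z := by
  have h1 := ρ.triangle x y z
  have h2 : ∑' n, (1 / 2 : ℝ) ^ (n + 2) * ρ.d (x * h n) (z * h n) ≤
      ∑' n, (1 / 2 : ℝ) ^ (n + 2) * ρ.d (x * h n) (y * h n) +
        ∑' n, (1 / 2 : ℝ) ^ (n + 2) * ρ.d (y * h n) (z * h n) := by
    rw [← (ρ.summable_fine h x y).tsum_add (ρ.summable_fine h y z)]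
    refine (ρ.summable_fine h x z).tsum_le_tsum (fun n => ?_)
      ((ρ.summable_fine h x y).add (ρ.summable_fine h y z))
    rw [← mul_add]
    exact mul_le_mul_of_nonneg_left (ρ.triangle _ _ _) (by positivity)
  simp only [fine]
  linarith

theorem fine_le_one (x y : G) : ρ.fine h x y ≤ 1 := by
  have h1 := ρ.le_one x y
  have h2 := (ρ.summable_fine h x y).tsum_le_tsum
    (fun n => mul_le_of_le_one_right (by positivity) (ρ.le_one _ _)) hasSum_weights.summable
  rw [hasSum_weights.tsum_eq] at h2
  simp only [fine]
  linarith

theorem half_le_fine (x y : G) : 1 / 2 * ρ.d x y ≤ ρ.fine h x y :=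
  le_add_of_nonneg_right (tsum_nonneg fun _ => mul_nonneg (by positivity) (ρ.nonneg _ _))

theorem fine_nonneg (x y : G) : 0 ≤ ρ.fine h x y :=
  (mul_nonneg (by norm_num) (ρ.nonneg x y)).trans (ρ.half_le_fine h x y)

theorem translate_le_fine (n : ℕ) (x y : G) :
    (1 / 2 : ℝ) ^ (n + 2) * ρ.d (x * h n) (y * h n) ≤ ρ.fine h x y :=
  ((ρ.summable_fine h x y).le_tsum n
    fun _ _ => mul_nonneg (by positivity) (ρ.nonneg _ _)).trans
    (le_add_of_nonneg_left (mul_nonneg (by norm_num) (ρ.nonneg x y)))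

theorem fine_left_inv (g x y : G) : ρ.fine h (g * x) (g * y) = ρ.fine h x y := by
  simp only [fine, mul_assoc, ρ.left_inv]

theorem tendsto_fine [ContinuousMul G] (x : G) : Tendsto (ρ.fine h x) (𝓝 x) (𝓝 0) := by
  have h1 : Tendsto (fun y => ∑' n, (1 / 2 : ℝ) ^ (n + 2) * ρ.d (x * h n) (y * h n)) (𝓝 x)
      (𝓝 (∑' _ : ℕ, (1 / 2 : ℝ) ^ (0 + 2) * 0)) := by
    refine tendsto_tsum_of_dominated_convergence hasSum_weights.summable (fun n => ?_)
      (Eventually.of_forall fun y n => ?_)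
    · have : Tendsto (fun y => ρ.d (x * h n) (y * h n)) (𝓝 x) (𝓝 0) :=
        (ρ.tendsto (x * h n)).comp ((continuous_mul_const (h n)).tendsto x)
      simpa using this.const_mul ((1 / 2 : ℝ) ^ (n + 2))
    · rw [Real.norm_of_nonneg (mul_nonneg (by positivity) (ρ.nonneg _ _))]
      exact mul_le_of_le_one_right (by positivity) (ρ.le_one _ _)
  have h2 := ((ρ.tendsto x).const_mul (1 / 2)).add h1
  simp only [mul_zero, tsum_zero, add_zero] at h2
  exact h2

/-- The excess over `1` of the distance between points of different colours. -/
noncomputable def link : ℕ → ℕ → G → G → ℝ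
  | 0, 0, _, _ => 0
  -- Vanishing at `y = x * h n`, the link records right translation by `h n`, which commutes with
  -- the left action.
  | 0, n + 1, x, y => (1 / 2 : ℝ) ^ (n + 2) * ρ.d (x * h n) y
  | n + 1, 0, x, y => (1 / 2 : ℝ) ^ (n + 2) * ρ.d x (y * h n)
  | _ + 1, _ + 1, x, y => 1 / 2 * ρ.d x y

theorem half_pow_le (n : ℕ) : (1 / 2 : ℝ) ^ (n + 2) ≤ 1 / 2 := by
  calc (1 / 2 : ℝ) ^ (n + 2) ≤ (1 / 2) ^ 1 :=
        pow_le_pow_of_le_one (by norm_num) (by norm_num) (by omega)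
    _ = 1 / 2 := pow_one _

theorem link_nonneg (i j : ℕ) (x y : G) : 0 ≤ ρ.link h i j x y := by
  rcases i with _ | i <;> rcases j with _ | j <;> simp only [link]
  · exact le_rfl
  all_goals exact mul_nonneg (by positivity) (ρ.nonneg _ _)

theorem link_le (i j : ℕ) (x y : G) : ρ.link h i j x y ≤ 1 / 2 := by
  rcases i with _ | i <;> rcases j with _ | j <;> simp only [link]
  · norm_num
  · exact (mul_le_of_le_one_right (by positivity) (ρ.le_one _ _)).trans (half_pow_le j)
  · exact (mul_le_of_le_one_right (by positivity) (ρ.le_one _ _)).trans (half_pow_le i)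
  · exact mul_le_of_le_one_right (by positivity) (ρ.le_one _ _)

theorem link_symm (i j : ℕ) (x y : G) : ρ.link h i j x y = ρ.link h j i y x := by
  rcases i with _ | i <;> rcases j with _ | j <;> simp only [link] <;> rw [ρ.symm]

theorem link_left_inv (i j : ℕ) (g x y : G) :
    ρ.link h i j (g * x) (g * y) = ρ.link h i j x y := by
  rcases i with _ | i <;> rcases j with _ | j <;> simp only [link, mul_assoc, ρ.left_inv]

/-- The translated terms in `fine` are there for the case of colours `0` and `j + 1`. -/
theorem link_triangle {i j : ℕ} (x y z : G) :
    ρ.link h i j x z ≤ ρ.fine h x y + ρ.link h i j y z := by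
  rcases i with _ | i <;> rcases j with _ | j <;> simp only [link]
  · linarith [ρ.fine_nonneg h x y]
  · have h1 := mul_le_mul_of_nonneg_left (ρ.triangle (x * h j) (y * h j) z)
      (show (0 : ℝ) ≤ (1 / 2) ^ (j + 2) by positivity)
    linarith [ρ.translate_le_fine h j x y]
  · have h1 := mul_le_mul_of_nonneg_left (ρ.triangle x y (z * h i))
      (show (0 : ℝ) ≤ (1 / 2) ^ (i + 2) by positivity)
    have h2 := mul_le_mul_of_nonneg_right (half_pow_le i) (ρ.nonneg x y)
    linarith [ρ.half_le_fine h x y]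
  · linarith [ρ.triangle x y z, ρ.half_le_fine h x y]

/-- The distance from the base point to the points of colour `i`. -/
noncomputable def level (i : ℕ) : ℝ := 3 / 2 + 1 / ((i : ℝ) + 3)

theorem level_gt (i : ℕ) : 3 / 2 < level i := by
  have : 0 < 1 / ((i : ℝ) + 3) := by positivity
  simp only [level]; linarith

theorem level_lt (i : ℕ) : level i < 2 := by
  have : 1 / ((i : ℝ) + 3) ≤ 1 / 3 :=
    one_div_le_one_div_of_le (by norm_num) (by linarith [Nat.cast_nonneg (α := ℝ) i])
  simp only [level]; linarith

/-- The levels decrease with shrinking gaps, so the level nearest to `level i` is the next one. Thus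
even an approximate distance to the base point determines the colour. -/
theorem level_separated (i : ℕ) :
    ∃ ε > 0, ∀ j, |level j - level i| < ε → j = i := by
  have hi : (0 : ℝ) < i + 3 := by positivity
  refine ⟨1 / ((i : ℝ) + 3) - 1 / ((i : ℝ) + 4), ?_, fun j hj => ?_⟩
  · exact sub_pos.2 (one_div_lt_one_div_of_lt hi (by linarith))
  · by_contra hne
    have hpos : (0 : ℝ) < j + 3 := by positivity
    simp only [level] at hj
    rcases Nat.lt_or_gt_of_ne hne with hlt | hlt
    · have h1 : (j : ℝ) + 1 ≤ i := by exact_mod_cast hlt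
      have h2 := (abs_lt.1 hj).2
      have h3 : 1 / ((i : ℝ) + 2) ≤ 1 / ((j : ℝ) + 3) :=
        one_div_le_one_div_of_le hpos (by linarith)
      have h4 : 1 / ((i : ℝ) + 3) - 1 / ((i : ℝ) + 4) ≤ 1 / ((i : ℝ) + 2) - 1 / ((i : ℝ) + 3) := by
        rw [div_sub_div _ _ (by positivity) (by positivity),
          div_sub_div _ _ (by positivity) (by positivity)]
        ring_nf
        exact inv_anti₀ (by positivity) (by linarith [Nat.cast_nonneg (α := ℝ) i])
      linarith
    · have h1 : (i : ℝ) + 1 ≤ j := by exact_mod_cast hlt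
      have h2 := (abs_lt.1 hj).1
      have h3 : 1 / ((j : ℝ) + 3) ≤ 1 / ((i : ℝ) + 4) :=
        one_div_le_one_div_of_le (by positivity) (by linarith)
      linarith

/-- Countably many coloured copies of `G` and a base point. -/
@[reducible] noncomputable def coloredSpace : PseudoMetricSpace (Option (ℕ × G)) where
  dist
    | none, none => 0
    | none, some (i, _) => level i
    | some (i, _), none => level i
    | some (i, x), some (j, y) => if i = j then ρ.fine h x y else 1 + ρ.link h i j x y
  dist_self := by
    rintro (_ | ⟨i, x⟩)
    · rfl
    · simp [ρ.fine_self]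
  dist_comm := by
    rintro (_ | ⟨i, x⟩) (_ | ⟨j, y⟩) <;> try rfl
    by_cases hij : i = j
    · simp [hij, ρ.fine_symm h x y]
    · simp [hij, Ne.symm hij, ρ.link_symm h i j x y]
  dist_triangle := by
    rintro (_ | ⟨i, x⟩) (_ | ⟨j, y⟩) (_ | ⟨k, z⟩)
    · simp
    · simp
    · simp only; linarith [level_gt j]
    · simp only
      split_ifs with hjk
      · subst hjk; linarith [ρ.fine_nonneg h y z]
      · linarith [level_lt k, level_gt j, ρ.link_nonneg h j k y z]
    · simp
    · simp only
      split_ifs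
      · linarith [level_gt i, level_gt k, ρ.fine_le_one h x z]
      · linarith [level_gt i, level_gt k, ρ.link_le h i k x z]
    · simp only
      split_ifs with hij
      · subst hij; linarith [ρ.fine_nonneg h x y]
      · linarith [level_lt i, level_gt j, ρ.link_nonneg h i j x y]
    · simp only
      by_cases hij : i = j
      · subst hij
        by_cases hik : i = k
        · simpa [hik] using ρ.fine_triangle h x y z
        · simp only [if_true, if_neg hik]
          linarith [ρ.link_triangle h (i := i) (j := k) x y z]
      · by_cases hjk : j = k
        · subst hjk
          simp only [if_true, if_neg hij]
          have := ρ.link_triangle h (i := j) (j := i) z y x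
          rw [ρ.link_symm h i j x z, ρ.link_symm h i j x y, ρ.fine_symm h y z]
          linarith
        -- Two changes of colour cost at least 2, while coloured points are at distance at most 3/2.
        · simp only [if_neg hij, if_neg hjk]
          have h1 := ρ.link_nonneg h i j x y
          have h2 := ρ.link_nonneg h j k y z
          split_ifs
          · linarith [ρ.fine_le_one h x z]
          · linarith [ρ.link_le h i k x z]

end LeftInvariantDist

/-! ### The action of `G` on the coloured space -/

/-- The coloured copies of `G` together with a base point. -/
def Colored {G : Type*} [Group G] [TopologicalSpace G] (_ρ : LeftInvariantDist G) (_h : ℕ → G) :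
    Type _ := Option (ℕ × G)

namespace Colored

variable {G : Type*} [Group G] [TopologicalSpace G] {ρ : LeftInvariantDist G} {h : ℕ → G}

noncomputable instance : PseudoMetricSpace (Colored ρ h) := ρ.coloredSpace h

/-- The base point. -/
def base : Colored ρ h := none

/-- The point of colour `i` corresponding to `x`. -/
def pt (i : ℕ) (x : G) : Colored ρ h := some (i, x)

theorem cases {p : Colored ρ h → Prop} (hb : p base) (hp : ∀ i x, p (pt i x)) : ∀ y, p y
  | none => hb
  | some (i, x) => hp i x

theorem dist_pt_base (i : ℕ) (x : G) :
    dist (pt i x : Colored ρ h) base = LeftInvariantDist.level i := rfl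

theorem dist_pt_self (i : ℕ) (x y : G) :
    dist (pt i x : Colored ρ h) (pt i y) = ρ.fine h x y := if_pos rfl

theorem dist_pt_of_ne {i j : ℕ} (hij : i ≠ j) (x y : G) :
    dist (pt i x : Colored ρ h) (pt j y) = 1 + ρ.link h i j x y := if_neg hij

theorem dist_pt_le (i j : ℕ) (x y : G) : dist (pt i x : Colored ρ h) (pt j y) ≤ 3 / 2 := by
  by_cases hij : i = j
  · subst hij; rw [dist_pt_self]; linarith [ρ.fine_le_one h x y]
  · rw [dist_pt_of_ne hij]; linarith [ρ.link_le h i j x y]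

theorem isFarPoint_base : LipFree.IsFarPoint (base : Colored ρ h) where
  dist_le_two := by
    refine cases (cases (by simp) fun i x => ?_) fun i x => cases ?_ fun j y => ?_
    · rw [dist_comm, dist_pt_base]; exact (LeftInvariantDist.level_lt i).le
    · rw [dist_pt_base]; exact (LeftInvariantDist.level_lt i).le
    · linarith [dist_pt_le (ρ := ρ) (h := h) i j x y]
  one_lt := by
    refine cases (fun hne => absurd rfl hne) fun i x _ => ?_
    rw [dist_pt_base]; linarith [LeftInvariantDist.level_gt i]
  lt_two := by
    refine cases (by simp) fun i x => ?_
    rw [dist_pt_base]; exact LeftInvariantDist.level_lt i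
  dist_le := by
    refine cases (fun _ hne => absurd rfl hne) fun i x => cases (fun _ => le_rfl) fun j y _ => ?_
    rw [dist_pt_base]
    exact (dist_pt_le i j x y).trans (LeftInvariantDist.level_gt i).le

/-- The action of `G` by left translations of every copy of `G`. -/
def act : G →* (Colored ρ h ≃ᵢ Colored ρ h) where
  toFun g :=
    { toFun := Option.map (Prod.map id (g * ·))
      invFun := Option.map (Prod.map id (g⁻¹ * ·))
      left_inv := by rintro (_ | ⟨i, x⟩) <;> simp <;> rfl
      right_inv := by rintro (_ | ⟨i, x⟩) <;> simp <;> rfl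
      isometry_toFun := by
        refine Isometry.of_dist_eq ?_
        refine cases (cases ((dist_self _).trans (dist_self _).symm) fun i x => rfl)
          fun i x => cases rfl fun j y => ?_
        change dist (pt i (g * x) : Colored ρ h) (pt j (g * y)) = _
        by_cases hij : i = j
        · subst hij; rw [dist_pt_self, dist_pt_self, ρ.fine_left_inv]
        · rw [dist_pt_of_ne hij, dist_pt_of_ne hij, ρ.link_left_inv] }
  map_one' := by
    ext1 y
    revert y
    refine cases rfl fun i x => ?_
    change (pt i (1 * x) : Colored ρ h) = pt i x
    rw [one_mul]
  map_mul' g k := by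
    ext1 y
    revert y
    refine cases rfl fun i x => ?_
    change (pt i (g * k * x) : Colored ρ h) = pt i (g * (k * x))
    rw [mul_assoc]

@[simp] theorem act_base (g : G) : act g (base : Colored ρ h) = base := rfl

open LipFree

theorem norm_δ_pt_sub (i : ℕ) (x y : G) :
    ‖δ (pt i x : Colored ρ h) - δ (pt i y)‖ = ρ.fine h x y := by
  rw [norm_δ_sub isFarPoint_base.dist_le_two, dist_pt_self]

theorem continuous_δ_pt [ContinuousMul G] (i : ℕ) :
    Continuous fun x => δ (pt i x : Colored ρ h) := by
  refine continuous_iff_continuousAt.2 fun x => tendsto_iff_norm_sub_tendsto_zero.2 ?_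
  refine (ρ.tendsto_fine h x).congr fun y => ?_
  rw [norm_δ_pt_sub, ρ.fine_symm]

/-- The pseudometric `fine` dominates `ρ.d / 2` and is still continuous, so it induces the topology
of `G`. -/
theorem isInducing_δ_pt [ContinuousMul G] (i : ℕ) :
    IsInducing fun x => δ (pt i x : Colored ρ h) := by
  refine isInducing_iff_nhds.2 fun x => le_antisymm
    ((continuous_δ_pt i).tendsto x).le_comap fun U hU => ?_
  obtain ⟨ε, hε, hU⟩ := ρ.mem_nhds x U hU
  refine ⟨Metric.ball (δ (pt i x)) (ε / 2), Metric.ball_mem_nhds _ (by positivity),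
    fun y hy => hU y ?_⟩
  have hy' : dist (δ (pt i y : Colored ρ h)) (δ (pt i x)) < ε / 2 := hy
  rw [dist_eq_norm, norm_δ_pt_sub, ρ.fine_symm] at hy'
  linarith [ρ.half_le_fine h x y]

theorem separableSpace_lipFree [ContinuousMul G] [TopologicalSpace.SeparableSpace G] :
    TopologicalSpace.SeparableSpace (LipFree (Colored ρ h)) := by
  refine LipFree.separableSpace ?_
  have : range (δ : Colored ρ h → _) ⊆ {δ base} ∪ ⋃ i : ℕ, range fun x => δ (pt i x) := by
    rintro _ ⟨y, rfl⟩
    revert y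
    exact cases (.inl rfl) fun i x => .inr (mem_iUnion.2 ⟨i, x, rfl⟩)
  exact ((finite_singleton _).isSeparable.union
    (.iUnion fun i => TopologicalSpace.isSeparable_range (continuous_δ_pt i))).mono this

/-! ### Isometries fixing the base point -/

variable (T : LipFree (Colored ρ h) ≃ₗᵢ[ℝ] LipFree (Colored ρ h))

theorem norm_apply_δ_pt_sub (hT : T (δ base) = δ base) (i : ℕ) (x : G) :
    ‖T (δ (pt i x)) - δ base‖ = LeftInvariantDist.level i := by
  conv_lhs => rw [← hT]
  rw [← map_sub, T.norm_map, norm_δ_sub isFarPoint_base.dist_le_two, dist_pt_base]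

theorem exists_norm_δ_pt_sub_lt (hT : T (δ base) = δ base) (i : ℕ) (x : G) {ε : ℝ} (hε : 0 < ε) :
    ∃ y, ‖δ (pt i y) - T (δ (pt i x))‖ < ε := by
  obtain ⟨η, hη, hsep⟩ := LeftInvariantDist.level_separated i
  -- Error below `η` forces the colour `i`; error below 1 excludes the base point, as levels exceed
  -- 3/2.
  obtain ⟨z, hz⟩ := exists_norm_δ_sub_lt isFarPoint_base T hT (pt i x)
    (ε := min ε (min η 1)) (by positivity)
  simp only [lt_min_iff] at hz
  have hn := norm_apply_δ_pt_sub T hT i x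
  revert z
  refine cases (fun hz => ?_) fun j y hz => ?_
  · rw [norm_sub_rev, hn] at hz
    linarith [LeftInvariantDist.level_gt i]
  · have h1 := abs_norm_sub_norm_le (δ (pt j y) - δ base) (T (δ (pt i x)) - δ base)
    rw [sub_sub_sub_cancel_right, hn, norm_δ_sub isFarPoint_base.dist_le_two, dist_pt_base] at h1
    obtain rfl := hsep j (h1.trans_lt hz.2.1)
    exact ⟨y, hz.1⟩

/-- Points which are nearest to a fixed point are fixed. -/
theorem apply_δ_pt_eq_of_link [ContinuousMul G] (hT : T (δ base) = δ base) {i j : ℕ} (hij : i ≠ j)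
    {x y : G} (hx : T (δ (pt i x)) = δ (pt i x)) (h0 : ρ.link h i j x y = 0)
    (hU : ∀ U ∈ 𝓝 y, ∃ η > 0, ∀ z, ρ.link h i j x z < η → z ∈ U) :
    T (δ (pt j y)) = δ (pt j y) := by
  refine eq_of_forall_dist_le fun ε hε => ?_
  obtain ⟨η, hη, hlink⟩ := hU _ ((continuous_δ_pt (ρ := ρ) (h := h) j).continuousAt.preimage_mem_nhds
    (Metric.ball_mem_nhds _ (half_pos hε)))
  obtain ⟨z, hz⟩ := exists_norm_δ_pt_sub_lt T hT j y (ε := min (ε / 2) η) (by positivity)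
  simp only [lt_min_iff] at hz
  -- The image stays at distance exactly 1 from the fixed point, so a Dirac measure near it has a
  -- small link to `x` and must lie near `y`.
  have h1 : ‖T (δ (pt j y)) - δ (pt i x)‖ = 1 := by
    rw [← hx, ← map_sub, T.norm_map, norm_sub_rev, norm_δ_sub isFarPoint_base.dist_le_two,
      dist_pt_of_ne hij, h0, add_zero]
  have h2 := norm_sub_le_norm_sub_add_norm_sub (δ (pt j z)) (T (δ (pt j y))) (δ (pt i x))
  rw [h1, norm_sub_rev (δ (pt j z)) (δ (pt i x)), norm_δ_sub isFarPoint_base.dist_le_two,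
    dist_pt_of_ne hij] at h2
  have h3 : dist (δ (pt j z)) (δ (pt j y : Colored ρ h)) < ε / 2 := hlink z (by linarith)
  have h4 := dist_triangle_left (T (δ (pt j y))) (δ (pt j y)) (δ (pt j z))
  rw [dist_eq_norm (δ (pt j z)) (T _)] at h4
  linarith

/-- The fixed point spreads along zero links: from `a` in copy 1 to `a` in every copy `n + 1`, then
to the dense set of `a * (h n)⁻¹` in copy 0, hence to all of copy 0, and back to every copy `n + 1`.
-/
theorem eq_one_of_apply_δ_pt_eq [IsTopologicalGroup G] (hd : DenseRange h)
    (hT : T (δ base) = δ base) {a : G} (ha : T (δ (pt 1 a)) = δ (pt 1 a)) : T = 1 := by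
  have h1 : ∀ n, T (δ (pt (n + 1) a)) = δ (pt (n + 1) a) := by
    rintro (_ | n)
    · exact ha
    · refine apply_δ_pt_eq_of_link T hT (by omega) ha (by simp [LeftInvariantDist.link, ρ.self])
        fun U hU => ?_
      obtain ⟨ε, hε, h⟩ := ρ.mem_nhds a U hU
      refine ⟨ε / 2, by positivity, fun z hz => h z ?_⟩
      simp only [LeftInvariantDist.link] at hz
      linarith
  have h2 : ∀ n, T (δ (pt 0 (a * (h n)⁻¹))) = δ (pt 0 (a * (h n)⁻¹)) := by
    intro n
    refine apply_δ_pt_eq_of_link T hT (by omega) (h1 n)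
      (by simp [LeftInvariantDist.link, ρ.self]) fun U hU => ?_
    obtain ⟨ε, hε, hs⟩ := ρ.mem_nhds a _
      ((continuous_mul_const (h n)⁻¹).continuousAt.preimage_mem_nhds hU)
    refine ⟨(1 / 2) ^ (n + 2) * ε, by positivity, fun z hz => ?_⟩
    have := hs (z * h n) (lt_of_mul_lt_mul_left hz (by positivity))
    simpa using this
  have h3 : ∀ y, T (δ (pt 0 y)) = δ (pt 0 y) := by
    have hd' : DenseRange fun n => a * (h n)⁻¹ :=
      ((Homeomorph.inv G).trans (Homeomorph.mulLeft a)).surjective.denseRange.comp hd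
        ((Homeomorph.inv G).trans (Homeomorph.mulLeft a)).continuous
    exact congrFun (hd'.equalizer (T.continuous.comp (continuous_δ_pt 0)) (continuous_δ_pt 0)
      (funext h2))
  have h4 : ∀ n y, T (δ (pt (n + 1) (y * h n))) = δ (pt (n + 1) (y * h n)) := by
    intro n y
    refine apply_δ_pt_eq_of_link T hT (by omega) (h3 y)
      (by simp [LeftInvariantDist.link, ρ.self]) fun U hU => ?_
    obtain ⟨ε, hε, hs⟩ := ρ.mem_nhds _ U hU
    exact ⟨(1 / 2) ^ (n + 2) * ε, by positivity,
      fun z hz => hs z (lt_of_mul_lt_mul_left hz (by positivity))⟩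
  refine isometryEquiv_ext_δ (cases hT ?_)
  rintro (_ | n) x
  · exact h3 x
  · simpa using h4 n (x * (h n)⁻¹)

/-- `T` restricts to a homeomorphism of the closure of the copy, a complete and hence Baire space in
which the copy is a dense Gδ. The copy therefore meets its preimage. -/
theorem exists_apply_δ_pt_eq [IsTopologicalGroup G] [PolishSpace G] (hT : T (δ base) = δ base)
    (i : ℕ) : ∃ a b, T (δ (pt i a)) = δ (pt i b) := by
  let X : Set (LipFree (Colored ρ h)) := closure (range fun x => δ (pt i x))
  have hmaps : ∀ S : LipFree (Colored ρ h) ≃ₗᵢ[ℝ] LipFree (Colored ρ h), S (δ base) = δ base →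
      ∀ v ∈ X, S v ∈ X := fun S hS => closure_minimal
    (by
      rintro _ ⟨x, rfl⟩
      refine Metric.mem_closure_iff.2 fun ε hε => ?_
      obtain ⟨y, hy⟩ := exists_norm_δ_pt_sub_lt S hS i x hε
      exact ⟨_, ⟨y, rfl⟩, by rwa [dist_comm, dist_eq_norm]⟩)
    (isClosed_closure.preimage S.continuous)
  have hsymm : T.symm (δ base) = δ base := by rw [LinearIsometryEquiv.symm_apply_eq, hT]
  let TX : X ≃ₜ X := T.toHomeomorph.subtype fun v =>
    ⟨hmaps T hT v, fun hv => by simpa using hmaps T.symm hsymm _ hv⟩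
  let j : G → X := fun x => ⟨δ (pt i x), subset_closure ⟨x, rfl⟩⟩
  have hj : IsInducing j := (IsInducing.subtypeVal.of_comp_iff).1 (isInducing_δ_pt i)
  have hd : DenseRange j := by
    rw [DenseRange, Subtype.dense_iff, ← range_comp]
    exact subset_rfl
  have : CompleteSpace X := isClosed_closure.completeSpace_coe
  have : Nonempty X := ⟨j 1⟩
  obtain ⟨a, b, hab⟩ := TX.exists_apply_eq_of_denseRange hj hd
  exact ⟨a, b, congrArg Subtype.val hab⟩

/-! ### The isomorphism of topological groups -/

/-- The action of `G` on `LipFree (Colored ρ h)`. -/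
noncomputable def toLinearIsometries :
    G →* linearIsometriesFixing (LipFree (Colored ρ h)) (δ base) :=
  (LipFree.map.comp act).codRestrict _ fun g => by
    change LipFree.map (act g) (δ base) = δ base
    simp

theorem toLinearIsometries_δ_pt (g : G) (i : ℕ) (x : G) :
    (toLinearIsometries g : linearIsometriesFixing (LipFree (Colored ρ h)) (δ base)).1 (δ (pt i x)) =
      δ (pt i (g * x)) := rfl

theorem surjective_toLinearIsometries [IsTopologicalGroup G] [PolishSpace G] (hd : DenseRange h) :
    Function.Surjective (toLinearIsometries (ρ := ρ) (h := h)) := by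
  intro T
  obtain ⟨a, b, hab⟩ := exists_apply_δ_pt_eq T.1 T.2 1
  refine ⟨b * a⁻¹, ?_⟩
  let S := (toLinearIsometries (b * a⁻¹))⁻¹ * T
  have hS : S.1 (δ (pt 1 a)) = δ (pt 1 a) := by
    change (toLinearIsometries (b * a⁻¹)).1.symm (T.1 (δ (pt 1 a))) = _
    rw [hab, LinearIsometryEquiv.symm_apply_eq, toLinearIsometries_δ_pt, inv_mul_cancel_right]
  exact inv_mul_eq_one.1 (Subtype.ext (eq_one_of_apply_δ_pt_eq S.1 hd S.2 hS))

theorem continuous_toLinearIsometries [ContinuousMul G] :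
    Continuous (toLinearIsometries (ρ := ρ) (h := h)) := by
  refine continuous_induced_rng.2 (continuous_induced_rng.2 (continuous_pi fun v => ?_))
  refine continuous_of_forall_δ (F := fun g : G => (toLinearIsometries (ρ := ρ) (h := h) g).1)
    (cases ?_ fun i x => ?_) v
  · exact continuous_const (y := δ base)
  · exact (continuous_δ_pt i).comp (continuous_mul_const x)

/-- Evaluation at the Dirac measure of `1` in copy 0 recovers the embedding of that copy, which is
already inducing. -/
theorem isInducing_toLinearIsometries [ContinuousMul G] :
    IsInducing (toLinearIsometries (ρ := ρ) (h := h)) := by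
  refine IsInducing.of_comp continuous_toLinearIsometries
    (g := fun T => T.1 (δ (pt 0 1))) ?_ ?_
  · exact (continuous_apply (δ (pt 0 1 : Colored ρ h))).comp
      (continuous_induced_dom.comp continuous_subtype_val)
  · have := isInducing_δ_pt (ρ := ρ) (h := h) 0
    convert this using 2 with g
    simp [toLinearIsometries_δ_pt]

theorem injective_toLinearIsometries [ContinuousMul G] [T0Space G] :
    Function.Injective (toLinearIsometries (ρ := ρ) (h := h)) :=
  isInducing_toLinearIsometries.injective

/-- `G` is the group of linear isometries fixing the base point. -/
noncomputable def continuousMulEquiv [IsTopologicalGroup G] [PolishSpace G] (hd : DenseRange h) :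
    G ≃ₜ* linearIsometriesFixing (LipFree (Colored ρ h)) (δ base) :=
  let e := MulEquiv.ofBijective (toLinearIsometries (ρ := ρ) (h := h))
    ⟨injective_toLinearIsometries, surjective_toLinearIsometries hd⟩
  { e with
    continuous_toFun := continuous_toLinearIsometries
    continuous_invFun := isInducing_toLinearIsometries.continuous_iff.2 <| by
      have : toLinearIsometries ∘ e.symm = id := funext e.apply_symm_apply
      change Continuous (toLinearIsometries ∘ e.symm)
      rw [this]
      exact continuous_id }

end Colored

universe u

theorem theorem1p2 (G : Type u) [Group G] [TopologicalSpace G] [IsTopologicalGroup G]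
    [PolishSpace G] :
    ∃ (E : Type u) (_ : NormedAddCommGroup E) (_ : NormedSpace ℝ E) (e : E),
      CompleteSpace E ∧ TopologicalSpace.SeparableSpace E ∧ e ≠ 0 ∧
        Nonempty (G ≃ₜ* linearIsometriesFixing E e) := by
  obtain ⟨ρ⟩ := exists_leftInvariantDist G
  let h : ℕ → G := TopologicalSpace.denseSeq G
  refine ⟨LipFree (Colored ρ h), inferInstance, inferInstance, LipFree.δ Colored.base,
    inferInstance, Colored.separableSpace_lipFree, ?_,
    ⟨Colored.continuousMulEquiv (TopologicalSpace.denseRange_denseSeq G)⟩⟩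
  rw [← norm_ne_zero_iff, LipFree.norm_δ]
  exact one_ne_zero
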